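/- Consider the Congested Clique with $n$ nodes: computation proceeds in synchronous rounds, in each round every node may send to every other node a (possibly different) message of $O(\log n)$ bits, and local computation is free. Suppose that every node initially stores $O(n)$ words of $O(\log n)$ bits each and has $O(n)$ queries, where a query is a pair consisting of a resolving node (any node of the network) and a content of $O(\log n)$ bits. Suppose that every query can be resolved by its resolving node, that is, the result of a query is given by a fixed known rule as a function of the content of the query, the resolving node and the words stored at the resolving node, and suppose that the result has $O(\log n)$ bits. The number of queries directed to one node is not restricted. Then there is a deterministic algorithm by which, in $O(1)$ rounds, every node obtains the results of all its queries. Precisely: write $L(n)=\lfloor\log_2 n\rfloor+1$ for $n\ge 1$. For all natural numbers $b\ge 1$ and $c$ there is $R$ such that for every $n$ and every rule for resolving queries there is a deterministic $R$-round algorithm in the $n$-node Congested Clique with messages of at most $b\,L(n)$ bits, such that on every input in which each node stores at most $cn$ words and has at most $cn$ queries, and in which every stored word, every content of a query and every result of a query has at most $c\,L(n)$ bits, each node outputs the results of all its queries. -/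

import Mathlib

namespace CongestedClique

/-- The length of a machine word in a network of `n` nodes: `⌊log₂ n⌋ + 1`, the
number of binary digits of `n ≥ 1`. A bit string has `O(log n)` bits if its length is at most a
constant times this number. -/
def wordLength (n : ℕ) : ℕ := Nat.log 2 n + 1

/-- A deterministic algorithm in the Congested Clique with `n` nodes, in which a message has at
most `bandwidth` bits. Node `i` knows `n`, its own name `i` and its local input. In round `t` every
node `i` sends to every node `j` a bit string `send t i s j`, which may differ from one receiver to
another and depends on the current local state `s` of `i` only; then it updates its state from the
messages it receives. Local computation and local memory are free. -/
structure Algorithm (n bandwidth : ℕ) (Input Output : Type) where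
  /-- local states of the nodes -/
  State : Type
  /-- the initial state of node `i`, computed from the local input -/
  init : Fin n → Input → State
  /-- `send t i s j` is the message from `i` to `j` in round `t` if `i` is in state `s` -/
  send : ℕ → Fin n → State → Fin n → List Bool
  /-- `recv t i s m` is the new state of `i` after round `t`, where `m j` is the message from `j` -/
  recv : ℕ → Fin n → State → (Fin n → List Bool) → State
  /-- the local output of node `i` -/
  output : Fin n → State → Output
  length_send_le : ∀ t i s j, (send t i s j).length ≤ bandwidth

namespace Algorithm

variable {n bandwidth : ℕ} {Input Output : Type}

/-- The local states of all nodes after `t` rounds, if node `i` has the local input `x i`. -/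
def stateAfter (A : Algorithm n bandwidth Input Output) (x : Fin n → Input) :
    ℕ → Fin n → A.State
  | 0, i => A.init i (x i)
  | t + 1, i => A.recv t i (A.stateAfter x t i) (fun j => A.send t j (A.stateAfter x t j) i)

/-- The local output of node `i` if the algorithm is stopped after `t` rounds. -/
def outputAfter (A : Algorithm n bandwidth Input Output) (x : Fin n → Input) (t : ℕ)
    (i : Fin n) : Output :=
  A.output i (A.stateAfter x t i)

end Algorithm

/-- A query: the resolving node and the content, a bit string. -/
structure Query (n : ℕ) where
  resolver : Fin n
  content : List Bool

/-- What a node has at the beginning: the words it stores and its list of queries. -/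
structure NodeInput (n : ℕ) where
  memory : List (List Bool)
  queries : List (Query n)

/-- A rule by which queries are resolved: `ρ u m a` is the result of a query with content `a` at
the resolving node `u` if `u` stores the words `m`. -/
abbrev Resolution (n : ℕ) : Type := Fin n → List (List Bool) → List Bool → List Bool

/-- The result of the query `q` in a network with the local inputs `x`: it is determined by the
content of `q`, the resolving node of `q`, and the words that this node stores. -/
def Resolution.result {n : ℕ} (ρ : Resolution n) (x : Fin n → NodeInput n) (q : Query n) :
    List Bool :=
  ρ q.resolver (x q.resolver).memory q.content

/-- The size bounds: every node stores at most `c * n` words and has at most `c * n` queries, and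
every stored word, every content of a query and every result has at most `c * wordLength n` bits.
There is no bound on the number of queries that are directed to one node. -/
structure SizeBounds {n : ℕ} (c : ℕ) (ρ : Resolution n) (x : Fin n → NodeInput n) : Prop where
  memory : ∀ i, (x i).memory.length ≤ c * n
  word : ∀ i, ∀ w ∈ (x i).memory, w.length ≤ c * wordLength n
  queries : ∀ i, (x i).queries.length ≤ c * n
  content : ∀ i, ∀ q ∈ (x i).queries, q.content.length ≤ c * wordLength n
  result : ∀ i, ∀ q ∈ (x i).queries, (ρ.result x q).length ≤ c * wordLength n

end CongestedClique

/-! Local computation is free, so an algorithm is judged only by what nodes can tell apart.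
`Learnable` records, for each node, a relation between possible worlds that equality of its states
implies. A message may be any function of what its sender has learned, and rounds are composed by
refining these relations. Objects obtained by choice (`rank`, `deal`, `edgeColouring`) depend only
on their arguments, so nodes that know the same arguments agree on them; this makes the algorithm
deterministic.

The obstacle is a node that is asked too often. With `N = c * n`, a node `v` with demand `d` gets `d
/ N` assistants. There are at most `n * N` queries, so these numbers sum to at most `n`, and each
node can assist a single `v` (`exists_fibers_ge`). Assistants copy the memory of `v` in two hops
through all nodes (`Learnable.memory`). Every source deals its queries to `v` evenly over `v` and
its assistants, so each server receives `O(n)` queries (`card_queries_of_server_le`). Routing then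
carries queries to servers and results back.

Routing (`Learnable.route`) uses about `√n` groups of about `√n` nodes. Sources spread their
messages so that every pair of a current group and a destination group has `O(n)` messages. In each
group, `Learnable.relay` colours the bipartite multigraph between holders and classes of messages.
With `O(n)` colours reduced modulo `n` to name relays, each relay gets `O(1)` messages from each
pair of a group and a class. The group can compute the colouring jointly because it depends only on
counts, which `Learnable.share` makes known inside the group. One use of this brings messages into
their destination group, a second one to their destination. -/

namespace CongestedClique

/-! ### What the nodes can learn in a number of rounds -/

section Learning

variable {n B R : ℕ} {I Ω : Type} {inp : Ω → Fin n → I} {r : Fin n → Ω → Ω → Prop}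

/-- `Learnable B inp R r`: there is an algorithm with bandwidth `B` such that, after `R` rounds,
node `i` can be in the same state for `ω` and `ω'` only if `r i ω ω'` holds. Here `inp ω` are the
local inputs in the possible world `ω`. -/
def Learnable (B : ℕ) (inp : Ω → Fin n → I) (R : ℕ) (r : Fin n → Ω → Ω → Prop) : Prop :=
  ∃ A : Algorithm n B I Unit, ∀ i ω ω',
    A.stateAfter (inp ω) R i = A.stateAfter (inp ω') R i → r i ω ω'

theorem Learnable.mono (h : Learnable B inp R r) {r' : Fin n → Ω → Ω → Prop}
    (hr : ∀ i ω ω', r i ω ω' → r' i ω ω') : Learnable B inp R r' := by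
  obtain ⟨A, hA⟩ := h
  exact ⟨A, fun i ω ω' e => hr _ _ _ (hA i ω ω' e)⟩

theorem learnable_input (B : ℕ) (inp : Ω → Fin n → I) :
    Learnable B inp 0 (fun i ω ω' => inp ω i = inp ω' i) :=
  ⟨{ State := I
     init := fun _ x => x
     send := fun _ _ _ _ => []
     recv := fun _ _ s _ => s
     output := fun _ _ => ()
     length_send_le := by simp }, fun _ _ _ h => h⟩

/-- A quantity that is determined by what the nodes have learned can be output. -/
theorem Learnable.exists_algorithm (h : Learnable B inp R r) {O : Type} [Nonempty O]
    (f : Ω → Fin n → O) (hf : ∀ i ω ω', r i ω ω' → f ω i = f ω' i) :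
    ∃ A : Algorithm n B I O, ∀ ω i, A.outputAfter (inp ω) R i = f ω i := by
  classical
  obtain ⟨A, hA⟩ := h
  let A' : Algorithm n B I O :=
    { State := A.State
      init := A.init
      send := A.send
      recv := A.recv
      -- The node picks any world compatible with its state; by `hf` all of them give the same
      -- value. The default is for states that no world realizes.
      output := fun i s =>
        if h : ∃ ω, A.stateAfter (inp ω) R i = s then f h.choose i else Classical.ofNonempty
      length_send_le := A.length_send_le }
  have hst : ∀ x t, A'.stateAfter x t = A.stateAfter x t := by
    intro x t
    induction t with
    | zero => rfl
    | succ t ih =>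
      funext i
      simp only [Algorithm.stateAfter, ih]
      rfl
  refine ⟨A', fun ω i => ?_⟩
  have hex : ∃ ω', A.stateAfter (inp ω') R i = A.stateAfter (inp ω) R i := ⟨ω, rfl⟩
  simp only [Algorithm.outputAfter, hst]
  change (if h : ∃ ω', A.stateAfter (inp ω') R i = A.stateAfter (inp ω) R i
    then f h.choose i else Classical.ofNonempty) = f ω i
  rw [dif_pos hex]
  exact hf _ _ _ (hA _ _ _ hex.choose_spec)

/-- One round, in which the message from `i` to `j` is a function of what `i` has learned. -/
theorem Learnable.round (h : Learnable B inp R r) (m : Ω → Fin n → Fin n → List Bool)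
    (hlen : ∀ ω i j, (m ω i j).length ≤ B) (hm : ∀ i ω ω', r i ω ω' → ∀ j, m ω i j = m ω' i j) :
    Learnable B inp (R + 1) (fun i ω ω' => r i ω ω' ∧ ∀ j, m ω j i = m ω' j i) := by
  classical
  obtain ⟨A, hA⟩ := h
  -- The empty default keeps the bandwidth bound valid in states that no possible world produces.
  let M : Fin n → A.State → Fin n → List Bool := fun i s j =>
    if h : ∃ ω, A.stateAfter (inp ω) R i = s then m h.choose i j else []
  have hM : ∀ ω i j, M i (A.stateAfter (inp ω) R i) j = m ω i j := by
    intro ω i j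
    have hex : ∃ ω', A.stateAfter (inp ω') R i = A.stateAfter (inp ω) R i := ⟨ω, rfl⟩
    simp only [M]
    rw [dif_pos hex]
    exact hm _ _ _ (hA _ _ _ hex.choose_spec) j
  let A' : Algorithm n B I Unit :=
    { State := A.State × (Fin n → List Bool)
      init := fun i x => (A.init i x, fun _ => [])
      send := fun t i s j => if t < R then A.send t i s.1 j else M i s.1 j
      recv := fun t i s μ => if t < R then (A.recv t i s.1 μ, s.2) else (s.1, μ)
      output := fun _ _ => ()
      length_send_le := by
        intro t i s j
        split_ifs
        · exact A.length_send_le _ _ _ _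
        · simp only [M]
          split_ifs
          · exact hlen _ _ _
          · simp }
  have hst : ∀ ω t, t ≤ R → ∀ i,
      A'.stateAfter (inp ω) t i = (A.stateAfter (inp ω) t i, fun _ => []) := by
    intro ω t
    induction t with
    | zero => intro _ i; rfl
    | succ t ih =>
      intro ht i
      have h1 : t < R := ht
      simp only [Algorithm.stateAfter, ih h1.le]
      simp [A', h1]
  have hlast : ∀ ω i, A'.stateAfter (inp ω) (R + 1) i =
      (A.stateAfter (inp ω) R i, fun j => m ω j i) := by
    intro ω i
    simp only [Algorithm.stateAfter, hst ω R le_rfl]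
    simp [A', hM]
  refine ⟨A', fun i ω ω' he => ?_⟩
  rw [hlast, hlast, Prod.mk.injEq] at he
  exact ⟨hA _ _ _ he.1, fun j => congrFun he.2 j⟩

/-- Messages of at most `D * B` bits can be sent in `D` rounds. -/
theorem Learnable.rounds (D : ℕ) (h : Learnable B inp R r) (m : Ω → Fin n → Fin n → List Bool)
    (hlen : ∀ ω i j, (m ω i j).length ≤ D * B)
    (hm : ∀ i ω ω', r i ω ω' → ∀ j, m ω i j = m ω' i j) :
    Learnable B inp (R + D) (fun i ω ω' => r i ω ω' ∧ ∀ j, m ω j i = m ω' j i) := by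
  induction D generalizing R r m with
  | zero =>
    have h0 : ∀ ω i j, m ω i j = [] := fun ω i j =>
      List.length_eq_zero_iff.1 (by simpa using hlen ω i j)
    exact h.mono fun i ω ω' hr => ⟨hr, fun j => by rw [h0, h0]⟩
  | succ D ih =>
    have h1 := h.round (fun ω i j => (m ω i j).take B) (fun ω i j => by simp)
      (fun i ω ω' hr j => by rw [hm i ω ω' hr j])
    have h2 := ih h1 (fun ω i j => (m ω i j).drop B)
      (fun ω i j => by
        have := hlen ω i j
        rw [List.length_drop]
        rw [Nat.succ_mul] at this
        omega)
      (fun i ω ω' hr j => by rw [hm i ω ω' hr.1 j])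
    rw [show R + (D + 1) = R + 1 + D by ring]
    refine h2.mono fun i ω ω' hr => ⟨hr.1.1, fun j => ?_⟩
    rw [← List.take_append_drop B (m ω j i), ← List.take_append_drop B (m ω' j i), hr.1.2 j,
      hr.2 j]

/-- A family of `T` messages of at most `D * B` bits for every pair of nodes. -/
theorem Learnable.family (T D : ℕ) (h : Learnable B inp R r)
    (m : Ω → Fin n → Fin n → ℕ → List Bool)
    (hlen : ∀ ω i j t, t < T → (m ω i j t).length ≤ D * B)
    (hm : ∀ i ω ω', r i ω ω' → ∀ j t, t < T → m ω i j t = m ω' i j t) :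
    Learnable B inp (R + T * D)
      (fun i ω ω' => r i ω ω' ∧ ∀ j t, t < T → m ω j i t = m ω' j i t) := by
  induction T with
  | zero => simpa using h
  | succ T ih =>
    have h1 := ih (fun ω i j t ht => hlen ω i j t (by omega))
      (fun i ω ω' hr j t ht => hm i ω ω' hr j t (by omega))
    have h2 := h1.rounds D (fun ω i j => m ω i j T) (fun ω i j => hlen ω i j T (by omega))
      (fun i ω ω' hr j => hm i ω ω' hr.1 j T (by omega))
    rw [show R + (T + 1) * D = R + T * D + D by ring]
    refine h2.mono fun i ω ω' hr => ⟨hr.1.1, fun j t ht => ?_⟩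
    rcases Nat.lt_succ_iff_lt_or_eq.1 ht with ht | rfl
    · exact hr.1.2 j t ht
    · exact hr.2 j

end Learning

/-! ### Bit strings -/

/-- An optional bit string as a bit string. -/
def optionCode : Option (List Bool) → List Bool
  | none => []
  | some l => true :: l

theorem optionCode_injective : Function.Injective optionCode := by
  rintro (_ | a) (_ | b) h <;> simp_all [optionCode]

/-- A pair of bit strings as a bit string. -/
def pairCode : List Bool → List Bool → List Bool
  | [], b => false :: b
  | x :: a, b => true :: x :: pairCode a b

theorem length_pairCode (a b : List Bool) :
    (pairCode a b).length = 2 * a.length + 1 + b.length := by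
  induction a with
  | nil => simp [pairCode]; omega
  | cons x a ih => simp [pairCode, ih]; omega

/-- The code is self-delimiting: every bit of the first string is announced by `true`, and the first
`false` in announcing position ends it. -/
theorem pairCode_inj {a b a' b' : List Bool} (h : pairCode a b = pairCode a' b') :
    a = a' ∧ b = b' := by
  induction a generalizing a' with
  | nil => cases a' <;> simp_all [pairCode]
  | cons x a ih =>
    cases a' with
    | nil => simp [pairCode] at h
    | cons y a' =>
      simp only [pairCode, List.cons.injEq, true_and] at h
      exact ⟨by rw [h.1, (ih h.2).1], (ih h.2).2⟩

theorem bits_injective : Function.Injective Nat.bits := by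
  intro a b h
  induction a using Nat.binaryRec' generalizing b with
  | zero =>
    by_contra hb
    have h1 := Nat.size_eq_bits_len b
    rw [← h, Nat.zero_bits, List.length_nil, eq_comm, Nat.size_eq_zero] at h1
    exact hb h1.symm
  | bit x a hx ih =>
    induction b using Nat.binaryRec' with
    | zero => rw [Nat.bits_append_bit a x hx] at h; simp at h
    | bit y b hy _ =>
      rw [Nat.bits_append_bit a x hx, Nat.bits_append_bit b y hy, List.cons.injEq] at h
      rw [ih h.2, h.1]

theorem one_le_wordLength (n : ℕ) : 1 ≤ wordLength n := Nat.le_add_left 1 _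

/-- Numbers up to `C * n` have `O(log n)` bits. -/
theorem length_bits_le {n a C : ℕ} (h : a ≤ C * n) :
    a.bits.length ≤ (C + 1) * wordLength n := by
  rw [Nat.size_eq_bits_len]
  refine (Nat.size_le.2 ?_ : a.size ≤ C + wordLength n).trans ?_
  · have h1 : n < 2 ^ wordLength n := Nat.lt_pow_succ_log_self (by norm_num) n
    calc a ≤ C * n := h
      _ ≤ 2 ^ C * n := Nat.mul_le_mul_right _ Nat.lt_two_pow_self.le
      _ < 2 ^ C * 2 ^ wordLength n := (Nat.mul_lt_mul_left (by positivity)).2 h1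
      _ = _ := (pow_add _ _ _).symm
  · have := one_le_wordLength n
    nlinarith


/-! ### Balanced assignments and edge colourings -/

section Combinatorics

variable {α β γ δ : Type*}

open Classical in
/-- An enumeration of the elements of `T` by `0, …, #T - 1`. -/
noncomputable def rank (T : Finset α) (e : α) : ℕ :=
  if h : e ∈ T then T.equivFin ⟨e, h⟩ else 0

theorem rank_lt {T : Finset α} {e : α} (he : e ∈ T) : rank T e < T.card := by
  rw [rank, dif_pos he]
  exact (T.equivFin ⟨e, he⟩).2

theorem rank_inj {T : Finset α} {e e' : α} (he : e ∈ T) (he' : e' ∈ T)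
    (h : rank T e = rank T e') : e = e' := by
  rw [rank, rank, dif_pos he, dif_pos he', Fin.val_inj] at h
  simpa using h

theorem exists_rank_eq {T : Finset α} {k : ℕ} (hk : k < T.card) : ∃ e ∈ T, rank T e = k := by
  refine ⟨(T.equivFin.symm ⟨k, hk⟩).1, (T.equivFin.symm ⟨k, hk⟩).2, ?_⟩
  rw [rank, dif_pos (T.equivFin.symm ⟨k, hk⟩).2]
  simp

/-- A set that is mapped injectively to numbers below `M * w`, all congruent modulo `w`, has at
most `M` elements. -/
theorem card_le_of_mod_eq (T : Finset α) (f : α → ℕ) {M w c : ℕ}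
    (hlt : ∀ e ∈ T, f e < w * M) (hinj : ∀ e ∈ T, ∀ e' ∈ T, f e = f e' → e = e')
    (hmod : ∀ e ∈ T, f e % w = c) : T.card ≤ M := by
  rw [← Finset.card_range M]
  refine Finset.card_le_card_of_injOn (fun e => f e / w) (fun e he => ?_) (fun e he e' he' h => ?_)
  · simpa using Nat.div_lt_of_lt_mul (hlt e he)
  · refine hinj e he e' he' ?_
    rw [← Nat.div_add_mod (f e) w, ← Nat.div_add_mod (f e') w, hmod e he, hmod e' he']
    simp only at h
    rw [h]

-- Number the elements of `T` and deal them cyclically, by rank modulo the size of `W`.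
open Classical in
theorem exists_balanced (T : Finset α) {W : Finset β} (hW : W.Nonempty) :
    ∃ f : α → β, (∀ e, f e ∈ W) ∧
      ∀ u, (T.filter (fun e => f e = u)).card ≤ T.card / W.card + 1 := by
  have hpos : 0 < W.card := hW.card_pos
  let g : α → Fin W.card := fun e => ⟨rank T e % W.card, Nat.mod_lt _ hpos⟩
  refine ⟨fun e => (W.equivFin.symm (g e)).1, fun e => (W.equivFin.symm (g e)).2, fun u => ?_⟩
  by_cases hu : u ∈ W
  · refine card_le_of_mod_eq _ (rank T) (w := W.card) (c := W.equivFin ⟨u, hu⟩) ?_ ?_ ?_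
    · intro e he
      exact (rank_lt (Finset.mem_filter.1 he).1).trans (Nat.lt_mul_div_succ _ hpos)
    · intro e he e' he' h
      exact rank_inj (Finset.mem_filter.1 he).1 (Finset.mem_filter.1 he').1 h
    · intro e he
      have h1 : W.equivFin.symm (g e) = ⟨u, hu⟩ := Subtype.ext (Finset.mem_filter.1 he).2
      rw [← h1, Equiv.apply_symm_apply]
  · rw [Finset.filter_false_of_mem]
    · simp
    · rintro e - rfl
      exact hu (W.equivFin.symm (g e)).2

open Classical in
/-- A balanced assignment of the elements of `T` to the elements of `W`. -/
noncomputable def deal [Nonempty β] (T : Finset α) (W : Finset β) : α → β :=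
  Classical.epsilon fun f => (∀ e, f e ∈ W) ∧
    ∀ u, (T.filter (fun e => f e = u)).card ≤ T.card / W.card + 1

theorem deal_mem [Nonempty β] (T : Finset α) {W : Finset β} (hW : W.Nonempty) (e : α) :
    deal T W e ∈ W :=
  (Classical.epsilon_spec (exists_balanced T hW)).1 e

theorem card_deal_le [Nonempty β] [DecidableEq β] (T : Finset α) {W : Finset β}
    (hW : W.Nonempty) (u : β) :
    (T.filter (fun e => deal T W e = u)).card ≤ T.card / W.card + 1 := by
  convert (Classical.epsilon_spec (exists_balanced T hW)).2 u
  rfl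

/-- A proper colouring of the edges of a bipartite multigraph of maximal degree `Δ`, with
`2 * Δ + 1` colours; `p` and `q` give the two ends of an edge. -/
def IsEdgeColouring (E : Finset α) (p : α → β) (q : α → γ) (Δ : ℕ) (χ : α → ℕ) : Prop :=
  (∀ e ∈ E, χ e < 2 * Δ + 1) ∧
    ∀ e ∈ E, ∀ e' ∈ E, p e = p e' ∨ q e = q e' → χ e = χ e' → e = e'

/-- The greedy edge colouring. -/
theorem exists_isEdgeColouring [DecidableEq β] [DecidableEq γ] (E : Finset α) (p : α → β)
    (q : α → γ) (Δ : ℕ) (hp : ∀ b, (E.filter (fun e => p e = b)).card ≤ Δ)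
    (hq : ∀ c, (E.filter (fun e => q e = c)).card ≤ Δ) : ∃ χ, IsEdgeColouring E p q Δ χ := by
  classical
  induction E using Finset.induction_on with
  | empty => exact ⟨fun _ => 0, by simp [IsEdgeColouring]⟩
  | insert a E ha ih =>
    obtain ⟨χ, h1, h2⟩ := ih
      (fun b => (Finset.card_le_card (Finset.filter_subset_filter _
        (Finset.subset_insert _ _))).trans (hp b))
      (fun b => (Finset.card_le_card (Finset.filter_subset_filter _
        (Finset.subset_insert _ _))).trans (hq b))
    -- At most `2 * Δ` edges share an end with `a`, so one of the `2 * Δ + 1` colours is free.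
    let F := E.filter (fun e => p e = p a) ∪ E.filter (fun e => q e = q a)
    have hF : (F.image χ).card < (Finset.range (2 * Δ + 1)).card := by
      have h3 := (Finset.card_le_card (Finset.filter_subset_filter (fun e => p e = p a)
        (Finset.subset_insert a E))).trans (hp (p a))
      have h4 := (Finset.card_le_card (Finset.filter_subset_filter (fun e => q e = q a)
        (Finset.subset_insert a E))).trans (hq (q a))
      have h5 : F.card ≤ _ := Finset.card_union_le _ _
      have h6 : (F.image χ).card ≤ F.card := Finset.card_image_le
      rw [Finset.card_range]
      omega
    obtain ⟨c, hc, hcF⟩ := Finset.exists_mem_notMem_of_card_lt_card hF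
    have hne : ∀ e ∈ E, p e = p a ∨ q e = q a → χ e ≠ c := by
      rintro e he hor rfl
      refine hcF (Finset.mem_image_of_mem _ ?_)
      simp only [F, Finset.mem_union, Finset.mem_filter]
      tauto
    have hE : ∀ e ∈ E, e ≠ a := fun e he h => ha (h ▸ he)
    refine ⟨fun e => if e = a then c else χ e, fun e he => ?_, fun e he e' he' hor hχ => ?_⟩
    · rcases Finset.mem_insert.1 he with rfl | he
      · simpa using hc
      · simpa [hE e he] using h1 e he
    · rcases Finset.mem_insert.1 he with rfl | hm <;> rcases Finset.mem_insert.1 he' with rfl | hm'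
      · rfl
      · simp only [if_true, if_neg (hE e' hm')] at hχ
        exact absurd hχ.symm (hne e' hm' (hor.imp Eq.symm Eq.symm))
      · simp only [if_true, if_neg (hE e hm)] at hχ
        exact absurd hχ (hne e hm hor)
      · simp only [if_neg (hE e hm), if_neg (hE e' hm')] at hχ
        exact h2 e hm e' hm' hor hχ

/-- Some edge colouring, if there is one. -/
noncomputable def edgeColouring (E : Finset α) (p : α → β) (q : α → γ) (Δ : ℕ) : α → ℕ :=
  Classical.epsilon (IsEdgeColouring E p q Δ)

/-- The elements of a finite type with at least `∑ v, h v` elements can be distributed such that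
every `v` obtains at least `h v` of them. -/
theorem exists_fibers_ge [Fintype α] [Fintype β] [Nonempty β] [DecidableEq β] (h : β → ℕ)
    (hsum : ∑ v, h v ≤ Fintype.card α) :
    ∃ own : α → β, ∀ v, h v ≤ (Finset.univ.filter (fun u => own u = v)).card := by
  classical
  -- There are `h v` slots for each `v`, embedded in `α`; elements outside the image go to an
  -- arbitrary `v`.
  have hc : Fintype.card (Σ v, Fin (h v)) ≤ Fintype.card α := by simpa using hsum
  obtain ⟨f⟩ := Function.Embedding.nonempty_of_card_le hc
  refine ⟨fun u => if hu : ∃ z, f z = u then hu.choose.1 else Classical.ofNonempty, fun v => ?_⟩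
  rw [← Fintype.card_fin (h v), ← Finset.card_univ]
  refine Finset.card_le_card_of_injOn (fun k => f ⟨v, k⟩) (fun k _ => ?_) (fun k _ k' _ hk => ?_)
  · have hex : ∃ z, f z = f ⟨v, k⟩ := ⟨_, rfl⟩
    simp only [Finset.coe_filter, Finset.mem_univ, true_and, Set.mem_ofPred_eq]
    rw [dif_pos hex, f.injective hex.choose_spec]
  · simpa using hk

theorem sum_div_le (T : Finset α) (f : α → ℕ) (w : ℕ) :
    ∑ e ∈ T, f e / w ≤ (∑ e ∈ T, f e) / w := by
  rcases Nat.eq_zero_or_pos w with rfl | hw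
  · simp
  · rw [Nat.le_div_iff_mul_le hw, Finset.sum_mul]
    exact Finset.sum_le_sum fun e _ => Nat.div_mul_le_self _ _

/-- A bound for the size of a set that is split by a function with values in a finite set. -/
theorem card_le_sum_fibers [DecidableEq β] (T : Finset α) (f : α → β) (W : Finset β)
    (h : ∀ e ∈ T, f e ∈ W) : T.card ≤ ∑ b ∈ W, (T.filter (fun e => f e = b)).card :=
  (Finset.card_eq_sum_card_fiberwise h).le

end Combinatorics

/-! ### Moving sets of messages -/

section Moving

variable {n B R : ℕ} {I Ω : Type} {inp : Ω → Fin n → I} {r : Fin n → Ω → Ω → Prop}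
  {α : Type}

/-- Every node knows which messages of `S` it holds, where `ℓ` is the holder. -/
def Holds (r : Fin n → Ω → Ω → Prop) (S : Ω → Finset α) (ℓ : Ω → α → Fin n) : Prop :=
  ∀ i ω ω', r i ω ω' → (S ω).filter (fun e => ℓ ω e = i) = (S ω').filter (fun e => ℓ ω' e = i)

theorem Holds.mono {S : Ω → Finset α} {ℓ : Ω → α → Fin n} (h : Holds r S ℓ)
    {r' : Fin n → Ω → Ω → Prop} (hr : ∀ i ω ω', r' i ω ω' → r i ω ω') : Holds r' S ℓ :=
  fun i ω ω' h' => h i ω ω' (hr _ _ _ h')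

/-- One can send at most `T` elements with codes of at most `D * B` bits from every node to every
node. -/
theorem Learnable.finsets [DecidableEq α] {D T : ℕ} (hB : 1 ≤ B) (h : Learnable B inp R r)
    (code : α → List Bool) (hcode : Function.Injective code)
    (F : Ω → Fin n → Fin n → Finset α)
    (hlen : ∀ ω i j, ∀ e ∈ F ω i j, (code e).length ≤ D * B)
    (hcard : ∀ ω i j, (F ω i j).card ≤ T)
    (hF : ∀ i ω ω', r i ω ω' → ∀ j, F ω i j = F ω' i j) :
    Learnable B inp (R + T * (D + 1)) (fun i ω ω' => r i ω ω' ∧ ∀ j, F ω j i = F ω' j i) := by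
  have h1 := h.family T (D + 1)
    -- The tag bit separates the end of the list from an empty code and accounts for `D + 1`.
    (fun ω i j t => optionCode (((F ω i j).toList[t]?).map code)) (fun ω i j t _ => ?_)
    (fun i ω ω' hr j t _ => by rw [hF i ω ω' hr j])
  · refine h1.mono fun i ω ω' hr => ⟨hr.1, fun j => ?_⟩
    have h2 : (F ω j i).toList = (F ω' j i).toList := by
      refine List.ext_getElem? fun t => ?_
      by_cases ht : t < T
      · exact Option.map_injective hcode (optionCode_injective (hr.2 j t ht))
      · rw [List.getElem?_eq_none, List.getElem?_eq_none]
        · have := hcard ω' j i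
          rw [Finset.length_toList]; omega
        · have := hcard ω j i
          rw [Finset.length_toList]; omega
    rw [← Finset.toList_toFinset (F ω j i), h2, Finset.toList_toFinset]
  · rcases h3 : (F ω i j).toList[t]? with _ | e
    · simp [optionCode]
    · have h4 := hlen ω i j e (Finset.mem_toList.1 (List.mem_of_getElem? h3))
      simp only [Option.map_some, optionCode, List.length_cons]
      nlinarith

/-- The messages move from the holders `ℓ` to the holders `ℓ'`, if the holders know where to send
the messages and have at most `T` messages for every receiver. -/
theorem Learnable.move [DecidableEq α] {D T : ℕ} (hB : 1 ≤ B) (h : Learnable B inp R r)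
    (code : α → List Bool) (hcode : Function.Injective code)
    {S : Ω → Finset α} (hlen : ∀ ω, ∀ e ∈ S ω, (code e).length ≤ D * B)
    {ℓ : Ω → α → Fin n} (hS : Holds r S ℓ) (ℓ' : Ω → α → Fin n)
    (hℓ' : ∀ i ω ω', r i ω ω' → ∀ e ∈ S ω, ℓ ω e = i → ℓ' ω e = ℓ' ω' e)
    (hcard : ∀ ω i j, ((S ω).filter (fun e => ℓ ω e = i ∧ ℓ' ω e = j)).card ≤ T) :
    ∃ r', Learnable B inp (R + T * (D + 1)) r' ∧ (∀ i ω ω', r' i ω ω' → r i ω ω') ∧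
      Holds r' S ℓ' := by
  let F : Ω → Fin n → Fin n → Finset α := fun ω i j =>
    (S ω).filter (fun e => ℓ ω e = i ∧ ℓ' ω e = j)
  refine ⟨_, h.finsets hB code hcode F (fun ω i j e he => hlen ω e (Finset.mem_filter.1 he).1)
    hcard ?_, fun i ω ω' hr => hr.1, ?_⟩
  · intro i ω ω' hr j
    have h1 := hS i ω ω' hr
    ext e
    have h2 := congrArg (e ∈ ·) h1
    simp only [Finset.mem_filter, eq_iff_iff] at h2
    simp only [F, Finset.mem_filter]
    constructor
    · rintro ⟨h3, h4, h5⟩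
      have h6 := h2.1 ⟨h3, h4⟩
      exact ⟨h6.1, h6.2, by rw [← hℓ' i ω ω' hr e h3 h4, h5]⟩
    · rintro ⟨h3, h4, h5⟩
      have h6 := h2.2 ⟨h3, h4⟩
      exact ⟨h6.1, h6.2, by rw [hℓ' i ω ω' hr e h6.1 h6.2, h5]⟩
  · intro i ω ω' hr
    ext e
    have h1 : ∀ ω, e ∈ (S ω).filter (fun e => ℓ' ω e = i) ↔ ∃ j, e ∈ F ω j i := by
      intro ω
      simp [F]
    rw [h1, h1]
    exact exists_congr fun j => by rw [hr.2 j]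

end Moving


/-! ### Routing -/

section Routing

variable {n B R s : ℕ} {I Ω : Type} {inp : Ω → Fin n → I} {r : Fin n → Ω → Ω → Prop}

/-- The nodes are divided into `s` groups, the residue classes modulo `s`. If every node knows
`4 * s` numbers, then all members of a group can learn the numbers of all members. -/
theorem Learnable.share {D : ℕ} (hs : 0 < s) (hsn : s * s ≤ n) (hns : n ≤ 4 * (s * s))
    (h : Learnable B inp R r) (X : Ω → Fin n → ℕ → ℕ)
    (hX : ∀ i ω ω', r i ω ω' → ∀ k < 4 * s, X ω i k = X ω' i k)
    (hlen : ∀ ω i k, (X ω i k).bits.length ≤ D * B) :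
    Learnable B inp (R + 4 * D + 16 * D) (fun i ω ω' => r i ω ω' ∧
      ∀ j : Fin n, (j : ℕ) % s = i % s → ∀ k < 4 * s, X ω j k = X ω' j k) := by
  -- Node `j` collects from every node the numbers whose index is congruent to `j` modulo `s`.
  have h1 := h.family 4 D (fun ω i j t => (X ω i (j % s + s * t)).bits)
    (fun ω i j t _ => hlen _ _ _) (fun i ω ω' hr j t ht => by
      rw [hX i ω ω' hr]
      have h2 : (j : ℕ) % s < s := Nat.mod_lt _ hs
      have h3 : s * t ≤ s * 3 := Nat.mul_le_mul_left s (by omega)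
      omega)
  let Y : Ω → ℕ → ℕ → ℕ := fun ω m k => if hm : m < n then X ω ⟨m, hm⟩ k else 0
  -- The digits of `j` in base `s` select an index residue and a residue of member positions. The 16
  -- values of `t` give the two leading digits, each below 4. Missing members count as 0.
  have h2 := h1.family 16 D
    (fun ω j i t => (Y ω (i % s + s * (j / s + s * (t / 4))) (j % s + s * (t % 4))).bits)
    (fun ω i j t _ => by
      simp only [Y]
      split_ifs
      · exact hlen _ _ _
      · simp)
    (fun j ω ω' hr i t ht => by
      simp only [Y]
      split_ifs
      · exact hr.2 _ _ (Nat.mod_lt _ (by norm_num))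
      · rfl)
  refine h2.mono fun i ω ω' hr => ⟨hr.1.1, fun i' hi' k hk => ?_⟩
  have hk1 : k % s < s := Nat.mod_lt _ hs
  have hi1 : (i' : ℕ) / s % s < s := Nat.mod_lt _ hs
  -- The node that forwards number `k` of member `i'`; it exists since `s * s ≤ n`.
  have hj : k % s + s * ((i' : ℕ) / s % s) < n := by
    have : s * ((i' : ℕ) / s % s) + s ≤ s * s := by nlinarith
    omega
  have hdiv : (k % s + s * ((i' : ℕ) / s % s)) / s = i' / s % s := by
    rw [Nat.add_mul_div_left _ _ hs, Nat.div_eq_of_lt hk1, zero_add]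
  have hmod : (k % s + s * ((i' : ℕ) / s % s)) % s = k % s := by
    rw [Nat.add_mul_mod_self_left, Nat.mod_mod]
  have hp : (i' : ℕ) / s / s < 4 := by
    have := i'.2
    rw [Nat.div_div_eq_div_mul]
    exact Nat.div_lt_of_lt_mul (by omega)
  have hq : k / s < 4 := Nat.div_lt_of_lt_mul (by omega)
  have h3 := bits_injective (hr.2 ⟨_, hj⟩ (4 * ((i' : ℕ) / s / s) + k / s) (by omega))
  have e1 : ∀ a b, b < 4 → (4 * a + b) / 4 = a ∧ (4 * a + b) % 4 = b := by omega
  have e2 : (i : ℕ) % s + s * (i' / s) = i' := by rw [← hi', Nat.mod_add_div]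
  simp only [Y, hdiv, hmod, (e1 _ _ hq).1, (e1 _ _ hq).2, Nat.mod_add_div, e2] at h3
  simpa using h3

variable {α : Type} [DecidableEq α]

/-- Every group colours the multigraph of its messages, whose edges join the holder of a message
and its class `κ`; the colour of a message is the relay to which it is sent. -/
theorem Learnable.relay {C D : ℕ} (hB : 1 ≤ B) (hbits : ∀ a ≤ C * n, a.bits.length ≤ D * B)
    (hs : 0 < s) (hsn : s * s ≤ n) (hns : n ≤ 4 * (s * s)) (h : Learnable B inp R r)
    (code : α → List Bool) (hcode : Function.Injective code)
    {S : Ω → Finset α} (hlen : ∀ ω, ∀ e ∈ S ω, (code e).length ≤ D * B)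
    {ℓ : Ω → α → Fin n} (hS : Holds r S ℓ) (κ : α → ℕ) (hκ : ∀ e, κ e < 4 * s)
    (hcard : ∀ ω i, ((S ω).filter (fun e => ℓ ω e = i)).card ≤ C * n)
    (hclass : ∀ ω g k,
      ((S ω).filter (fun e => (ℓ ω e : ℕ) % s = g ∧ κ e = k)).card ≤ C * n) :
    ∃ r' ℓ', Learnable B inp (R + 4 * D + 16 * D + (2 * C + 1) * (D + 1)) r' ∧
      (∀ i ω ω', r' i ω ω' → r i ω ω') ∧ Holds r' S ℓ' ∧
      ∀ ω m g k, ((S ω).filter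
        (fun e => ℓ' ω e = m ∧ (ℓ ω e : ℕ) % s = g ∧ κ e = k)).card ≤ 2 * C + 1 := by
  rcases Nat.eq_zero_or_pos n with hn | hn
  · have : 0 < s * s := by positivity
    omega
  let own : Ω → Fin n → ℕ → Finset α := fun ω i k =>
    (S ω).filter (fun e => ℓ ω e = i ∧ κ e = k)
  have hown : ∀ i ω ω', r i ω ω' → ∀ k, own ω i k = own ω' i k := by
    intro i ω ω' hr k
    have h1 := hS i ω ω' hr
    simp only [own, ← Finset.filter_filter]
    rw [h1]
  let X : Ω → Fin n → ℕ → ℕ := fun ω i k => (own ω i k).card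
  have h1 := h.share (D := D) hs hsn hns X (fun i ω ω' hr k _ => by simp only [X, hown i ω ω' hr k])
    (fun ω i k => hbits _ ((Finset.card_le_card (Finset.monotone_filter_right _
      (fun e _ he => he.1))).trans (hcard ω i)))
  -- Edges are named by holder, class and rank instead of by message. Then the counts `X` alone
  -- determine the edge set (`hE`), and all members of a group compute the same colouring.
  let edge : Ω → α → Fin n × ℕ × ℕ := fun ω e =>
    (ℓ ω e, κ e, rank (own ω (ℓ ω e) (κ e)) e)
  have hmem : ∀ ω, ∀ e ∈ S ω, e ∈ own ω (ℓ ω e) (κ e) := fun ω e he => by simp [own, he]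
  have hedge : ∀ ω, ∀ e ∈ S ω, ∀ e' ∈ S ω, edge ω e = edge ω e' → e = e' := by
    intro ω e he e' he' hee
    simp only [edge, Prod.mk.injEq] at hee
    obtain ⟨h2, h3, h4⟩ := hee
    have h5 := hmem ω e' he'
    rw [← h2, ← h3] at h4 h5
    exact rank_inj (hmem ω e he) h5 h4
  let E : Ω → ℕ → Finset (Fin n × ℕ × ℕ) := fun ω g =>
    ((S ω).filter (fun e => (ℓ ω e : ℕ) % s = g)).image (edge ω)
  have hE : ∀ ω g i k t, (i, k, t) ∈ E ω g ↔
      (i : ℕ) % s = g ∧ k < 4 * s ∧ t < X ω i k := by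
    intro ω g i k t
    simp only [E, Finset.mem_image, Finset.mem_filter, edge, Prod.mk.injEq]
    constructor
    · rintro ⟨e, ⟨he, rfl⟩, rfl, rfl, rfl⟩
      exact ⟨rfl, hκ e, rank_lt (hmem ω e he)⟩
    · rintro ⟨rfl, hk, ht⟩
      obtain ⟨e, he, rfl⟩ := exists_rank_eq ht
      obtain ⟨h2, rfl, rfl⟩ := Finset.mem_filter.1 he
      exact ⟨e, ⟨h2, rfl⟩, rfl, rfl, rfl⟩
  let χ : Ω → ℕ → Fin n × ℕ × ℕ → ℕ := fun ω g =>
    edgeColouring (E ω g) (fun z => z.1) (fun z => z.2.1) (C * n)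
  have hχ : ∀ ω g, IsEdgeColouring (E ω g) (fun z => z.1) (fun z => z.2.1) (C * n) (χ ω g) := by
    intro ω g
    refine Classical.epsilon_spec (exists_isEdgeColouring _ _ _ _ (fun i => ?_) (fun k => ?_))
    · refine le_trans ?_ (hcard ω i)
      rw [Finset.filter_image]
      refine Finset.card_image_le.trans (Finset.card_le_card fun e he => ?_)
      simp only [Finset.mem_filter, edge] at he ⊢
      exact ⟨he.1.1, he.2⟩
    · refine le_trans ?_ (hclass ω g k)
      rw [Finset.filter_image]
      refine Finset.card_image_le.trans (Finset.card_le_card fun e he => ?_)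
      simp only [Finset.mem_filter, edge] at he ⊢
      exact ⟨he.1.1, he.1.2, he.2⟩
  let col : Ω → α → ℕ := fun ω e => χ ω (ℓ ω e % s) (edge ω e)
  have hcolE : ∀ ω, ∀ e ∈ S ω, edge ω e ∈ E ω (ℓ ω e % s) := fun ω e he =>
    Finset.mem_image_of_mem _ (by simp [he])
  have hcol_lt : ∀ ω, ∀ e ∈ S ω, col ω e < n * (2 * C + 1) := by
    intro ω e he
    have := (hχ ω (ℓ ω e % s)).1 _ (hcolE ω e he)
    simp only [col]
    nlinarith
  have hcol_inj : ∀ ω, ∀ e ∈ S ω, ∀ e' ∈ S ω, (ℓ ω e : ℕ) % s = ℓ ω e' % s →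
      ℓ ω e = ℓ ω e' ∨ κ e = κ e' → col ω e = col ω e' → e = e' := by
    intro ω e he e' he' hg hor hc
    refine hedge ω e he e' he' ?_
    simp only [col] at hc
    rw [← hg] at hc
    have h2 := hcolE ω e' he'
    rw [← hg] at h2
    exact (hχ ω _).2 _ (hcolE ω e he) _ h2 hor hc
  let ℓ' : Ω → α → Fin n := fun ω e => ⟨col ω e % n, Nat.mod_lt _ hn⟩
  have hknow : ∀ i ω ω', (r i ω ω' ∧ ∀ j : Fin n, (j : ℕ) % s = i % s →
      ∀ k < 4 * s, X ω j k = X ω' j k) → ∀ e ∈ S ω, ℓ ω e = i → ℓ' ω e = ℓ' ω' e := by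
    intro i ω ω' hr e he hi
    have h5 : ℓ ω' e = i := by
      have := Finset.ext_iff.1 (hS i ω ω' hr.1) e
      simp only [Finset.mem_filter] at this
      exact (this.1 ⟨he, hi⟩).2
    have h6 : E ω (i % s) = E ω' (i % s) := by
      ext ⟨j, k, t⟩
      rw [hE, hE]
      refine and_congr_right fun hj => and_congr_right fun hk => ?_
      rw [hr.2 j hj k hk]
    simp only [ℓ', col, χ, edge, hi, h5, h6, hown i ω ω' hr.1]
  have hload : ∀ ω i j,
      ((S ω).filter (fun e => ℓ ω e = i ∧ ℓ' ω e = j)).card ≤ 2 * C + 1 := by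
    intro ω i j
    -- Messages of one holder have distinct colours below `n * (2 * C + 1)`, so each residue modulo
    -- `n` occurs at most `2 * C + 1` times.
    refine card_le_of_mod_eq _ (col ω) (w := n) (c := j) (fun e he => ?_) (fun e he e' he' => ?_)
      (fun e he => ?_)
    · exact hcol_lt ω e (Finset.mem_filter.1 he).1
    · obtain ⟨he, hi, -⟩ := Finset.mem_filter.1 he
      obtain ⟨he', hi', -⟩ := Finset.mem_filter.1 he'
      exact hcol_inj ω e he e' he' (by rw [hi, hi']) (Or.inl (hi.trans hi'.symm))
    · rw [← (Finset.mem_filter.1 he).2.2]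
  obtain ⟨r', h2, h3, h4⟩ := h1.move (T := 2 * C + 1) (D := D) hB code hcode hlen
    (hS.mono fun _ _ _ hr => hr.1) ℓ' hknow hload
  refine ⟨r', ℓ', h2, fun i ω ω' hr => (h3 i ω ω' hr).1, h4, fun ω m g k => ?_⟩
  refine card_le_of_mod_eq _ (col ω) (w := n) (c := m) (fun e he => ?_) (fun e he e' he' => ?_)
    (fun e he => ?_)
  · exact hcol_lt ω e (Finset.mem_filter.1 he).1
  · obtain ⟨he, -, hg, hk⟩ := Finset.mem_filter.1 he
    obtain ⟨he', -, hg', hk'⟩ := Finset.mem_filter.1 he'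
    exact hcol_inj ω e he e' he' (hg.trans hg'.symm) (Or.inr (hk.trans hk'.symm))
  · rw [← (Finset.mem_filter.1 he).2.1]

end Routing


/-! ### Residue classes of nodes and the initial spreading of messages -/

section Groups

variable {n s : ℕ}

/-- The nodes whose number is congruent to `w` modulo `s`. -/
def group (n s w : ℕ) : Finset (Fin n) := Finset.univ.filter (fun i => (i : ℕ) % s = w)

theorem mem_group {w : ℕ} {i : Fin n} : i ∈ group n s w ↔ (i : ℕ) % s = w := by simp [group]

theorem le_card_group {w : ℕ} (hsn : s * s ≤ n) (hw : w < s) : s ≤ (group n s w).card := by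
  have hlt : ∀ a < s, w + s * a < n := fun a ha => by nlinarith
  calc s = (Finset.univ : Finset (Fin s)).card := by simp
    _ ≤ _ := Finset.card_le_card_of_injOn
        (fun a : Fin s => (⟨w + s * a, hlt a a.2⟩ : Fin n)) ?_ ?_
  · intro a _
    simp [mem_group, Nat.mod_eq_of_lt hw]
  · intro a _ a' _ h
    simpa [Fin.ext_iff, (Nat.zero_lt_of_lt hw).ne'] using h

theorem group_nonempty {w : ℕ} (hsn : s * s ≤ n) (hw : w < s) : (group n s w).Nonempty :=
  Finset.card_pos.1 ((Nat.zero_lt_of_lt hw).trans_le (le_card_group hsn hw))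

theorem card_group_le (w : ℕ) (hns : n ≤ 4 * (s * s)) : (group n s w).card ≤ 4 * s :=
  card_le_of_mod_eq _ (fun i : Fin n => (i : ℕ)) (w := s) (c := w)
    (fun i _ => i.2.trans_le (by linarith)) (fun _ _ _ _ h => Fin.ext h)
    (fun _ hi => mem_group.1 hi)

variable {α : Type} [Nonempty (Fin n)] (T : Finset α) (G : α → ℕ)

/-- The group to which a node with the messages `T` sends the message `e`: the messages with the
same destination group are distributed evenly over all groups. -/
noncomputable def spreadGroup (s : ℕ) (e : α) : ℕ :=
  deal (T.filter (fun e' => G e' = G e)) (Finset.range s) e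

/-- The node to which a node with the messages `T` sends the message `e`. -/
noncomputable def spread (n s : ℕ) [Nonempty (Fin n)] (e : α) : Fin n :=
  deal (T.filter (fun e' => spreadGroup T G s e' = spreadGroup T G s e))
    (group n s (spreadGroup T G s e)) e

variable {T G}

theorem spreadGroup_lt (hs : 0 < s) (e : α) : spreadGroup T G s e < s :=
  Finset.mem_range.1 (deal_mem _ (Finset.nonempty_range_iff.2 hs.ne') e)

theorem spread_mod (hs : 0 < s) (hsn : s * s ≤ n) (e : α) :
    (spread T G n s e : ℕ) % s = spreadGroup T G s e :=
  mem_group.1 (deal_mem _ (group_nonempty hsn (spreadGroup_lt hs e)) e)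

theorem card_spreadGroup_le (hs : 0 < s) (g w : ℕ) :
    (T.filter (fun e => G e = g ∧ spreadGroup T G s e = w)).card ≤
      (T.filter (fun e => G e = g)).card / s + 1 := by
  have h := card_deal_le (T.filter (fun e => G e = g)) (Finset.nonempty_range_iff.2 hs.ne') w
  rw [Finset.card_range, Finset.filter_filter] at h
  refine le_trans (Finset.card_le_card fun e he => ?_) h
  simp only [Finset.mem_filter] at he ⊢
  obtain ⟨h1, rfl, h3⟩ := he
  exact ⟨h1, rfl, h3⟩

/-- Rounding costs at most one message per destination group, so a group receives at most `T.card /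
s + s ≤ (4 * C + 1) * s` messages. Dealing these to at least `s` members costs one more by rounding.
-/
theorem card_spread_le {C : ℕ} (hs : 0 < s) (hsn : s * s ≤ n) (hns : n ≤ 4 * (s * s))
    (hG : ∀ e, G e < s) (hT : T.card ≤ C * n) (j : Fin n) :
    (T.filter (fun e => spread T G n s e = j)).card ≤ 4 * C + 2 := by
  set w := (j : ℕ) % s with hw
  have hws : w < s := Nat.mod_lt _ hs
  have h1 : (T.filter (fun e => spreadGroup T G s e = w)).card ≤ (4 * C + 1) * s := by
    calc _ ≤ ∑ g ∈ Finset.range s,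
          ((T.filter (fun e => spreadGroup T G s e = w)).filter (fun e => G e = g)).card :=
          card_le_sum_fibers _ _ _ fun e _ => Finset.mem_range.2 (hG e)
      _ ≤ ∑ g ∈ Finset.range s, ((T.filter (fun e => G e = g)).card / s + 1) := by
          refine Finset.sum_le_sum fun g _ => ?_
          rw [Finset.filter_filter]
          simp only [and_comm]
          exact card_spreadGroup_le hs g w
      _ ≤ T.card / s + s := by
          rw [Finset.sum_add_distrib]
          refine add_le_add ((sum_div_le _ _ _).trans (Nat.div_le_div_right ?_)) (by simp)
          exact (Finset.card_eq_sum_card_fiberwise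
            fun e _ => Finset.mem_coe.2 (Finset.mem_range.2 (hG e))).ge
      _ ≤ (4 * C + 1) * s := by
          have h2 : T.card / s ≤ 4 * C * s := by
            refine Nat.div_le_of_le_mul (hT.trans ?_)
            calc C * n ≤ C * (4 * (s * s)) := Nat.mul_le_mul_left _ hns
              _ = _ := by ring
          linarith
  have h3 := card_deal_le (T.filter (fun e => spreadGroup T G s e = w))
    (group_nonempty hsn hws) j
  have h4 : (T.filter (fun e => spreadGroup T G s e = w)).card / (group n s w).card ≤ 4 * C + 1 :=
    Nat.div_le_of_le_mul (h1.trans (by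
      rw [mul_comm]; exact Nat.mul_le_mul_right _ (le_card_group hsn hws)))
  refine (Finset.card_le_card fun e he => ?_).trans (h3.trans (by omega))
  simp only [Finset.mem_filter] at he ⊢
  have h5 : spreadGroup T G s e = w := by rw [← spread_mod hs hsn, he.2]
  refine ⟨⟨he.1, h5⟩, ?_⟩
  rw [← he.2, spread, h5]

end Groups

/-! ### The constant-round routing theorem -/

section Routing

variable {n B R s : ℕ} {I Ω : Type} {inp : Ω → Fin n → I} {r : Fin n → Ω → Ω → Prop}
  {α : Type}

/-- Assignments that are computed by the holders. -/
theorem Holds.eq_of_local {S : Ω → Finset α} {ℓ : Ω → α → Fin n} (hS : Holds r S ℓ)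
    (f : Finset α → α → Fin n) (i : Fin n) (ω ω' : Ω) (hr : r i ω ω') (e : α) (he : e ∈ S ω)
    (hi : ℓ ω e = i) :
    f ((S ω).filter (fun e' => ℓ ω e' = ℓ ω e)) e =
      f ((S ω').filter (fun e' => ℓ ω' e' = ℓ ω' e)) e := by
  have h1 := hS i ω ω' hr
  have h2 := Finset.ext_iff.1 h1 e
  simp only [Finset.mem_filter] at h2
  rw [(h2.1 ⟨he, hi⟩).2, hi, h1]

theorem card_le_of_load {T : ℕ} (S : Finset α) (ℓ ℓ' : α → Fin n) (j : Fin n)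
    (h : ∀ i, (S.filter (fun e => ℓ e = i ∧ ℓ' e = j)).card ≤ T) :
    (S.filter (fun e => ℓ' e = j)).card ≤ T * n := by
  calc _ ≤ ∑ i, ((S.filter (fun e => ℓ' e = j)).filter (fun e => ℓ e = i)).card :=
        card_le_sum_fibers _ _ _ fun e _ => Finset.mem_univ _
    _ ≤ ∑ _i : Fin n, T := by
        refine Finset.sum_le_sum fun i _ => ?_
        rw [Finset.filter_filter]
        simp only [and_comm]
        exact h i
    _ = T * n := by simp [mul_comm]

/-- The number of rounds that the routing takes. -/
def routeRounds (C D : ℕ) : ℕ :=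
  (4 * C + 2) * (D + 1) + 4 * D + 16 * D + (2 * (4 * C + 2) + 1) * (D + 1) +
    (2 * (4 * C + 2) + 2) * (D + 1) + 4 * D + 16 * D +
    (2 * (2 * (4 * C + 2) + 2) + 1) * (D + 1) + (2 * (2 * (4 * C + 2) + 2) + 1) * (D + 1)

/-- Routing: if every node is the source and the destination of at most `C * n` messages, then all
messages can be delivered in a constant number of rounds. -/
theorem Learnable.route [DecidableEq α] {C D : ℕ} (hn : 0 < n) (hB : 1 ≤ B)
    (hbits : ∀ a ≤ (8 * C + 6) * n, a.bits.length ≤ D * B) (h : Learnable B inp R r)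
    (code : α → List Bool) (hcode : Function.Injective code)
    {S : Ω → Finset α} (hlen : ∀ ω, ∀ e ∈ S ω, (code e).length ≤ D * B)
    (src dst : α → Fin n) (hS : Holds r S (fun _ => src))
    (hsrc : ∀ ω i, ((S ω).filter (fun e => src e = i)).card ≤ C * n)
    (hdst : ∀ ω i, ((S ω).filter (fun e => dst e = i)).card ≤ C * n) :
    ∃ r', Learnable B inp (R + routeRounds C D) r' ∧ (∀ i ω ω', r' i ω ω' → r i ω ω') ∧
      Holds r' S (fun _ => dst) := by
  have : Nonempty (Fin n) := ⟨⟨0, hn⟩⟩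
  obtain ⟨s, hs, hsn, hns⟩ : ∃ s, 0 < s ∧ s * s ≤ n ∧ n ≤ 4 * (s * s) := by
    -- The upper bound holds because `n < (s + 1)^2 ≤ (2 * s)^2`.
    refine ⟨n.sqrt, Nat.sqrt_pos.2 hn, Nat.sqrt_le n, ?_⟩
    have h1 := Nat.lt_succ_sqrt n
    have h2 := Nat.sqrt_pos.2 hn
    simp only [Nat.succ_eq_add_one] at h1
    nlinarith
  let G : α → ℕ := fun e => (dst e : ℕ) % s
  have hG : ∀ e, G e < s := fun e => Nat.mod_lt _ hs
  -- the messages are spread over all nodes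
  let ℓ₁ : Ω → α → Fin n := fun ω e => spread ((S ω).filter (fun e' => src e' = src e)) G n s e
  have load₁ : ∀ ω i j, ((S ω).filter (fun e => src e = i ∧ ℓ₁ ω e = j)).card ≤ 4 * C + 2 := by
    intro ω i j
    refine le_trans (Finset.card_le_card fun e he => ?_)
      (card_spread_le (T := (S ω).filter (fun e => src e = i)) hs hsn hns hG (hsrc ω i) j)
    simp only [Finset.mem_filter, ℓ₁] at he ⊢
    obtain ⟨h1, rfl, h3⟩ := he
    exact ⟨⟨h1, rfl⟩, h3⟩
  obtain ⟨r₁, hL₁, hr₁, hS₁⟩ := h.move (T := 4 * C + 2) hB code hcode hlen hS ℓ₁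
    (hS.eq_of_local fun T e => spread T G n s e) load₁
  have hclass₁ : ∀ ω w g, ((S ω).filter (fun e => (ℓ₁ ω e : ℕ) % s = w ∧ G e = g)).card ≤
      (4 * C + 2) * n := by
    intro ω w g
    -- A destination group has at most `4 * s` members. Each source sends a fraction `1 / s` of its
    -- messages for group `g` to group `w`, up to a rounding error of one per source.
    have h1 : ((S ω).filter (fun e => G e = g)).card ≤ s * (4 * C * n) := by
      calc _ ≤ ∑ j ∈ group n s g,
            (((S ω).filter (fun e => G e = g)).filter (fun e => dst e = j)).card :=
            card_le_sum_fibers _ _ _ fun e he => mem_group.2 (Finset.mem_filter.1 he).2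
        _ ≤ ∑ j ∈ group n s g, C * n := Finset.sum_le_sum fun j _ =>
            (Finset.card_le_card (Finset.filter_subset_filter _
              (Finset.filter_subset _ _))).trans (hdst ω j)
        _ = (group n s g).card * (C * n) := by simp
        _ ≤ 4 * s * (C * n) := Nat.mul_le_mul_right _ (card_group_le g hns)
        _ = _ := by ring
    calc _ ≤ ∑ i, (((S ω).filter (fun e => (ℓ₁ ω e : ℕ) % s = w ∧ G e = g)).filter
            (fun e => src e = i)).card :=
          card_le_sum_fibers _ _ _ fun e _ => Finset.mem_univ _
      _ ≤ ∑ i, ((((S ω).filter (fun e => G e = g)).filter (fun e => src e = i)).card / s + 1) := by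
          refine Finset.sum_le_sum fun i _ => ?_
          have h2 := card_spreadGroup_le (T := (S ω).filter (fun e => src e = i)) (G := G) hs g w
          have h3 : ((S ω).filter (fun e => G e = g)).filter (fun e => src e = i) =
              ((S ω).filter (fun e => src e = i)).filter (fun e => G e = g) :=
            Finset.filter_comm _ _ _
          rw [h3]
          refine (Finset.card_le_card fun e he => ?_).trans h2
          simp only [Finset.mem_filter, ℓ₁, spread_mod hs hsn] at he ⊢
          obtain ⟨⟨h4, h5, h6⟩, rfl⟩ := he
          exact ⟨⟨h4, rfl⟩, h6, h5⟩
      _ ≤ ((S ω).filter (fun e => G e = g)).card / s + n := by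
          rw [Finset.sum_add_distrib]
          refine add_le_add ((sum_div_le _ _ _).trans (Nat.div_le_div_right ?_)) (by simp)
          exact (Finset.card_eq_sum_card_fiberwise fun e _ => Finset.mem_coe.2
            (Finset.mem_univ _)).ge
      _ ≤ 4 * C * n + n := Nat.add_le_add_right (Nat.div_le_of_le_mul h1) _
      _ ≤ _ := by nlinarith
  -- relays for the destination groups
  obtain ⟨r₂, ℓ₂, hL₂, hr₂, hS₂, hclass₂⟩ := hL₁.relay (C := 4 * C + 2) (D := D) (s := s) hB
    (fun a ha => hbits a (ha.trans (Nat.mul_le_mul_right _ (by omega)))) hs hsn hns code hcode hlen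
    hS₁ G (fun e => (hG e).trans_le (by omega))
    (fun ω i => card_le_of_load _ _ _ _ fun j => load₁ ω j i) hclass₁
  -- the relays distribute the messages over the members of the destination group
  let f : Finset α → α → Fin n := fun T e => deal (T.filter (fun e' => G e' = G e))
    (group n s (G e)) e
  have hf : ∀ T e, (f T e : ℕ) % s = G e := fun T e =>
    mem_group.1 (deal_mem _ (group_nonempty hsn (hG e)) e)
  let ℓ₃ : Ω → α → Fin n := fun ω e => f ((S ω).filter (fun e' => ℓ₂ ω e' = ℓ₂ ω e)) e
  have load₃ : ∀ ω i j, ((S ω).filter (fun e => ℓ₂ ω e = i ∧ ℓ₃ ω e = j)).card ≤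
      2 * (4 * C + 2) + 2 := by
    intro ω i j
    have hj : (j : ℕ) % s < s := Nat.mod_lt _ hs
    set T := (S ω).filter (fun e => ℓ₂ ω e = i) with hT
    -- A relay holds at most `2 * (4 * C + 2) + 1` messages for this destination group from each of
    -- the `s` groups that sent them.
    have h1 : (T.filter (fun e => G e = j % s)).card ≤ s * (2 * (4 * C + 2) + 1) := by
      calc _ ≤ ∑ w ∈ Finset.range s,
            ((T.filter (fun e => G e = j % s)).filter (fun e => (ℓ₁ ω e : ℕ) % s = w)).card :=
            card_le_sum_fibers _ _ _ fun e _ => Finset.mem_range.2 (Nat.mod_lt _ hs)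
        _ ≤ ∑ w ∈ Finset.range s, (2 * (4 * C + 2) + 1) := by
            refine Finset.sum_le_sum fun w _ => ?_
            refine (Finset.card_le_card fun e he => ?_).trans (hclass₂ ω i w (j % s))
            simp only [hT, Finset.mem_filter] at he ⊢
            tauto
        _ = _ := by simp
    have h2 := card_deal_le (T.filter (fun e => G e = j % s)) (group_nonempty hsn hj) j
    have h3 : (T.filter (fun e => G e = j % s)).card / (group n s (j % s)).card ≤
        2 * (4 * C + 2) + 1 :=
      Nat.div_le_of_le_mul (h1.trans (Nat.mul_le_mul_right _ (le_card_group hsn hj)))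
    refine (Finset.card_le_card fun e he => ?_).trans (h2.trans (Nat.add_le_add_right h3 1))
    simp only [hT, Finset.mem_filter, ℓ₃] at he ⊢
    obtain ⟨h4, rfl, h5⟩ := he
    have h6 : G e = j % s := by rw [← h5, hf]
    refine ⟨⟨⟨h4, rfl⟩, h6⟩, ?_⟩
    rw [← h6]
    exact h5
  obtain ⟨r₃, hL₃, hr₃, hS₃⟩ := hL₂.move (T := 2 * (4 * C + 2) + 2) hB code hcode hlen hS₂ ℓ₃
    (hS₂.eq_of_local f) load₃
  -- relays for the destinations
  have hdst_eq : ∀ j e, G e = (j : ℕ) % s → (dst e : ℕ) / s = j / s → (dst e : ℕ) = j := by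
    intro j e h1 h2
    rw [← Nat.mod_add_div (dst e) s, ← Nat.mod_add_div j s, h2]
    simp only [G] at h1
    rw [h1]
  -- Messages are now in their destination group, so the class `dst e / s` singles out one
  -- destination and `hdst` bounds its size. Nodes hold up to `(8 * C + 6) * n` messages, hence the
  -- constant in `hbits`.
  obtain ⟨r₄, ℓ₄, hL₄, hr₄, hS₄, hclass₄⟩ := hL₃.relay (C := 2 * (4 * C + 2) + 2) (D := D) (s := s)
    hB (fun a ha => hbits a (ha.trans (Nat.mul_le_mul_right _ (by omega)))) hs hsn hns code hcode
    hlen hS₃ (fun e => (dst e : ℕ) / s)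
    (fun e => Nat.div_lt_of_lt_mul ((dst e).2.trans_le (by linarith)))
    (fun ω i => card_le_of_load _ _ _ _ fun j => load₃ ω j i)
    (fun ω g k => by
      rcases Finset.eq_empty_or_nonempty
        ((S ω).filter (fun e => (ℓ₃ ω e : ℕ) % s = g ∧ (dst e : ℕ) / s = k)) with h0 | ⟨e₀, he₀⟩
      · rw [h0]; simp
      · refine (Finset.card_le_card fun e he => ?_).trans ((hdst ω (dst e₀)).trans
          (Nat.mul_le_mul_right _ (by omega)))
        simp only [Finset.mem_filter, ℓ₃, hf] at he he₀ ⊢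
        exact ⟨he.1, Fin.ext (hdst_eq _ e (he.2.1.trans he₀.2.1.symm)
          (he.2.2.trans he₀.2.2.symm))⟩)
  obtain ⟨r₅, hL₅, hr₅, hS₅⟩ := hL₄.move (T := 2 * (2 * (4 * C + 2) + 2) + 1) hB code hcode hlen hS₄
    (fun _ => dst) (fun _ _ _ _ _ _ _ => rfl) (fun ω m j => by
      refine (Finset.card_le_card fun e he => ?_).trans (hclass₄ ω m (j % s) (j / s))
      simp only [Finset.mem_filter, ℓ₃, hf] at he ⊢
      obtain ⟨h1, h2, rfl⟩ := he
      exact ⟨h1, h2, rfl, rfl⟩)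
  refine ⟨r₅, ?_, fun i ω ω' hr => hr₁ _ _ _ (hr₂ _ _ _ (hr₃ _ _ _ (hr₄ _ _ _ (hr₅ _ _ _ hr)))),
    hS₅⟩
  convert hL₅ using 1
  simp only [routeRounds]
  ring

end Routing


/-! ### Answering queries -/

section Queries

variable {n : ℕ}

/-- The indices of the queries of `i` that are directed to `v`. -/
def queriesTo (x : Fin n → NodeInput n) (i v : Fin n) : Finset ℕ :=
  (Finset.range (x i).queries.length).filter
    (fun k => ((x i).queries[k]?).map Query.resolver = some v)

/-- The content of the query of `i` with index `k`. -/
def contentOf (x : Fin n → NodeInput n) (i : Fin n) (k : ℕ) : List Bool :=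
  (((x i).queries[k]?).map Query.content).getD []

theorem mem_queriesTo {x : Fin n → NodeInput n} {i v : Fin n} {k : ℕ} :
    k ∈ queriesTo x i v ↔
      ∃ q, (x i).queries[k]? = some q ∧ q.resolver = v ∧ contentOf x i k = q.content := by
  simp only [queriesTo, contentOf, Finset.mem_filter, Finset.mem_range, Option.map_eq_some_iff]
  constructor
  · rintro ⟨-, q, hq, rfl⟩
    exact ⟨q, hq, rfl, by simp [hq]⟩
  · rintro ⟨q, hq, rfl, -⟩
    exact ⟨(List.getElem?_eq_some_iff.1 hq).1, q, hq, rfl⟩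

theorem queriesTo_congr {x y : Fin n → NodeInput n} {i : Fin n} (h : x i = y i) (v : Fin n) :
    queriesTo x i v = queriesTo y i v := by
  simp only [queriesTo, h]

theorem contentOf_congr {x y : Fin n → NodeInput n} {i : Fin n} (h : x i = y i) (k : ℕ) :
    contentOf x i k = contentOf y i k := by
  simp only [contentOf, h]

theorem sum_card_queriesTo_le (x : Fin n → NodeInput n) (i : Fin n) :
    ∑ v, (queriesTo x i v).card ≤ (x i).queries.length := by
  classical
  rw [← Finset.card_biUnion]
  · rw [← Finset.card_range (x i).queries.length]
    refine Finset.card_le_card fun k hk => ?_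
    obtain ⟨v, -, hv⟩ := Finset.mem_biUnion.1 hk
    exact (Finset.mem_filter.1 hv).1
  · intro v _ v' _ hne
    refine Finset.disjoint_left.2 fun k hk hk' => hne ?_
    exact Option.some_injective _ ((Finset.mem_filter.1 hk).2.symm.trans (Finset.mem_filter.1 hk').2)

/-- The number of queries that are directed to `v`. -/
def demand (x : Fin n → NodeInput n) (v : Fin n) : ℕ := ∑ i, (queriesTo x i v).card

theorem sum_demand_le {x : Fin n → NodeInput n} {N : ℕ}
    (hx : ∀ i, (x i).queries.length ≤ N) : ∑ v, demand x v ≤ n * N := by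
  simp only [demand]
  rw [Finset.sum_comm]
  calc _ ≤ ∑ _i : Fin n, N :=
        Finset.sum_le_sum fun i _ => (sum_card_queriesTo_le x i).trans (hx i)
    _ = n * N := by simp

/-- The node that `u` assists, if `v` needs `h v` assistants. -/
noncomputable def assisted (h : Fin n → ℕ) : Fin n → Fin n :=
  haveI : Nonempty (Fin n → Fin n) := ⟨id⟩
  Classical.epsilon fun own => ∀ v, h v ≤ (Finset.univ.filter (fun u => own u = v)).card

/-- The nodes that resolve the queries directed to `v`: the node `v` and its assistants. -/
noncomputable def servers (h : Fin n → ℕ) (v : Fin n) : Finset (Fin n) :=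
  insert v (Finset.univ.filter (fun u => assisted h u = v))

theorem servers_nonempty (h : Fin n → ℕ) (v : Fin n) : (servers h v).Nonempty :=
  Finset.insert_nonempty _ _

theorem mem_servers {h : Fin n → ℕ} {u v : Fin n} :
    u ∈ servers h v ↔ v = u ∨ v = assisted h u := by
  simp [servers, eq_comm]

theorem le_card_servers {h : Fin n → ℕ} (hsum : ∑ v, h v ≤ n) (v : Fin n) :
    h v ≤ (servers h v).card := by
  have : Nonempty (Fin n) := ⟨v⟩
  refine le_trans ?_ (Finset.card_le_card (Finset.subset_insert v _))
  exact Classical.epsilon_spec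
    (p := fun own : Fin n → Fin n => ∀ v, h v ≤ (Finset.univ.filter (fun u => own u = v)).card)
    (exists_fibers_ge h (by simpa using hsum)) v

/-- All queries: `(i, v, k)` is the query of `i` with index `k`, directed to `v`. -/
def allQueries (x : Fin n → NodeInput n) : Finset (Fin n × Fin n × ℕ) :=
  Finset.univ.biUnion fun i => Finset.univ.biUnion fun v =>
    (queriesTo x i v).image fun k => (i, v, k)

theorem mem_allQueries {x : Fin n → NodeInput n} {i v : Fin n} {k : ℕ} :
    (i, v, k) ∈ allQueries x ↔ k ∈ queriesTo x i v := by
  simp [allQueries]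

/-- The node that resolves a query. -/
noncomputable def server (x : Fin n → NodeInput n) (h : Fin n → ℕ)
    (p : Fin n × Fin n × ℕ) : Fin n :=
  haveI : Nonempty (Fin n) := ⟨p.1⟩
  deal (queriesTo x p.1 p.2.1) (servers h p.2.1) p.2.2

theorem server_mem (x : Fin n → NodeInput n) (h : Fin n → ℕ) (p : Fin n × Fin n × ℕ) :
    server x h p ∈ servers h p.2.1 :=
  haveI : Nonempty (Fin n) := ⟨p.1⟩
  deal_mem _ (servers_nonempty _ _) _

theorem server_congr {x y : Fin n → NodeInput n} {i : Fin n} (hi : x i = y i) (h : Fin n → ℕ)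
    (v : Fin n) (k : ℕ) : server x h (i, v, k) = server y h (i, v, k) := by
  simp only [server, queriesTo_congr hi]

theorem card_queries_of_source_le (x : Fin n → NodeInput n) (i : Fin n) :
    ((allQueries x).filter (fun p => p.1 = i)).card ≤ (x i).queries.length := by
  calc _ ≤ ∑ v, (((allQueries x).filter (fun p => p.1 = i)).filter (fun p => p.2.1 = v)).card :=
        card_le_sum_fibers _ _ _ fun _ _ => Finset.mem_univ _
    _ ≤ ∑ v, (queriesTo x i v).card := by
        refine Finset.sum_le_sum fun v _ => ?_
        refine Finset.card_le_card_of_injOn (fun p => p.2.2) ?_ ?_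
        · rintro ⟨i', v', k⟩ hp
          simp only [Finset.coe_filter, Finset.mem_filter, Set.mem_ofPred_eq] at hp
          obtain ⟨⟨hp, rfl⟩, rfl⟩ := hp
          exact mem_allQueries.1 hp
        · rintro ⟨i', v', k⟩ hp ⟨i₂, v₂, k₂⟩ hp₂ hk
          simp only [Finset.coe_filter, Finset.mem_filter, Set.mem_ofPred_eq] at hp hp₂ hk
          obtain ⟨⟨-, rfl⟩, rfl⟩ := hp
          obtain ⟨⟨-, rfl⟩, rfl⟩ := hp₂
          rw [hk]
    _ ≤ _ := sum_card_queriesTo_le x i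

/-- A node serves only itself and the node it assists, hence the outer factor 2. For each such `v`,
rounding costs one per source, so `n`. The even share is at most `2 * N`, because `demand x v < N *
(h v + 1)` and there are at least `max (h v) 1` servers. -/
theorem card_queries_of_server_le {x : Fin n → NodeInput n} {N : ℕ} (hN : 0 < N)
    (hx : ∀ i, (x i).queries.length ≤ N) (u : Fin n) :
    ((allQueries x).filter (fun p => server x (fun v => demand x v / N) p = u)).card ≤
      2 * (2 * N + n) := by
  have : Nonempty (Fin n) := ⟨u⟩
  set h : Fin n → ℕ := fun v => demand x v / N with hh
  have hsum : ∑ v, h v ≤ n :=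
    (sum_div_le _ _ _).trans (Nat.div_le_of_le_mul ((sum_demand_le hx).trans_eq (mul_comm _ _)))
  let V : Finset (Fin n) := {u, assisted h u}
  have hpair : ∀ v i, ((((allQueries x).filter (fun p => server x h p = u)).filter
      (fun p => p.2.1 = v)).filter (fun p => p.1 = i)).card ≤
        (queriesTo x i v).card / (servers h v).card + 1 := by
    intro v i
    refine le_trans ?_ (card_deal_le (queriesTo x i v) (servers_nonempty h v) u)
    refine Finset.card_le_card_of_injOn (fun p => p.2.2) ?_ ?_
    · rintro ⟨i', v', k⟩ hp
      simp only [Finset.coe_filter, Finset.mem_filter, Set.mem_ofPred_eq] at hp ⊢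
      obtain ⟨⟨⟨hp, hu⟩, rfl⟩, rfl⟩ := hp
      exact ⟨mem_allQueries.1 hp, hu⟩
    · rintro ⟨i', v', k⟩ hp ⟨i₂, v₂, k₂⟩ hp₂ hk
      simp only [Finset.coe_filter, Finset.mem_filter, Set.mem_ofPred_eq] at hp hp₂ hk
      obtain ⟨⟨-, rfl⟩, rfl⟩ := hp
      obtain ⟨⟨-, rfl⟩, rfl⟩ := hp₂
      rw [hk]
  calc _ ≤ ∑ v ∈ V, (((allQueries x).filter (fun p => server x h p = u)).filter
          (fun p => p.2.1 = v)).card := by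
        refine card_le_sum_fibers _ _ _ fun p hp => ?_
        have h1 := server_mem x h p
        rw [(Finset.mem_filter.1 hp).2, mem_servers] at h1
        simpa [V] using h1
    _ ≤ ∑ v ∈ V, (2 * N + n) := by
        refine Finset.sum_le_sum fun v _ => ?_
        calc _ ≤ ∑ i, _ := card_le_sum_fibers _ (fun p => p.1) Finset.univ
              fun p _ => Finset.mem_univ _
          _ ≤ ∑ i, ((queriesTo x i v).card / (servers h v).card + 1) :=
              Finset.sum_le_sum fun i _ => hpair v i
          _ ≤ demand x v / (servers h v).card + n := by
              rw [Finset.sum_add_distrib]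
              exact add_le_add (sum_div_le _ _ _) (by simp)
          _ ≤ 2 * N + n := by
              refine Nat.add_le_add_right (Nat.div_le_of_le_mul ?_) _
              have h1 : demand x v < N * (h v + 1) := Nat.lt_mul_div_succ _ hN
              have h2 := le_card_servers hsum v
              have h3 := (servers_nonempty h v).card_pos
              nlinarith
    _ ≤ 2 * (2 * N + n) := by
        rw [Finset.sum_const, smul_eq_mul]
        exact Nat.mul_le_mul_right _ Finset.card_le_two

/-- A message: source, destination, and content. -/
abbrev Message (n : ℕ) : Type := Fin n × Fin n × List Bool

/-- A message as a bit string. -/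
def Message.code (e : Message n) : List Bool :=
  pairCode (e.1 : ℕ).bits (pairCode (e.2.1 : ℕ).bits e.2.2)

theorem Message.code_injective : Function.Injective (Message.code (n := n)) := by
  rintro ⟨i, j, a⟩ ⟨i', j', a'⟩ h
  obtain ⟨h1, h2⟩ := pairCode_inj h
  obtain ⟨h2, h3⟩ := pairCode_inj h2
  simp only [Prod.mk.injEq]
  exact ⟨Fin.ext (bits_injective h1), Fin.ext (bits_injective h2), h3⟩

theorem Message.length_code_le (e : Message n) {D : ℕ} (h : e.2.2.length ≤ D * wordLength n) :
    e.code.length ≤ (D + 10) * wordLength n := by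
  have h1 := length_bits_le (C := 1) (n := n) (a := e.1) (by have := e.1.2; omega)
  have h2 := length_bits_le (C := 1) (n := n) (a := e.2.1) (by have := e.2.1.2; omega)
  have h3 := one_le_wordLength n
  rw [Message.code, length_pairCode, length_pairCode]
  nlinarith

/-- The messages that carry the queries to the servers. -/
noncomputable def queryMessages (x : Fin n → NodeInput n) (h : Fin n → ℕ) : Finset (Message n) :=
  (allQueries x).image fun p => (p.1, server x h p,
    pairCode p.2.2.bits (pairCode (p.2.1 : ℕ).bits (contentOf x p.1 p.2.2)))

/-- The messages that carry the results back. -/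
noncomputable def resultMessages (ρ : Resolution n) (x : Fin n → NodeInput n) (h : Fin n → ℕ) :
    Finset (Message n) :=
  (allQueries x).image fun p => (server x h p, p.1,
    pairCode p.2.2.bits (ρ p.2.1 (x p.2.1).memory (contentOf x p.1 p.2.2)))

/-- A source can compose its messages from its own input and the common `h`. Equality follows by
symmetry. -/
theorem queryMessages_subset {x y : Fin n → NodeInput n} {h : Fin n → ℕ} {i : Fin n}
    (hi : x i = y i) : (queryMessages x h).filter (fun e => e.1 = i) ⊆
      (queryMessages y h).filter (fun e => e.1 = i) := by
  intro e he
  simp only [queryMessages, Finset.mem_filter, Finset.mem_image, Prod.exists] at he ⊢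
  obtain ⟨⟨i', v, k, hp, rfl⟩, rfl⟩ := he
  refine ⟨⟨i', v, k, ?_, ?_⟩, rfl⟩
  · rw [mem_allQueries] at hp ⊢
    rwa [← queriesTo_congr hi]
  · rw [server_congr hi, contentOf_congr hi]

/-- A server decodes source, index, resolver and content from the messages it received. The resolver
is the server itself or the node it assists, so the server knows the memory that is needed. -/
theorem resultMessages_subset {ρ : Resolution n} {x y : Fin n → NodeInput n} {h : Fin n → ℕ}
    {u : Fin n} (hu : (x u).memory = (y u).memory)
    (ha : (x (assisted h u)).memory = (y (assisted h u)).memory)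
    (hq : (queryMessages x h).filter (fun e => e.2.1 = u) =
      (queryMessages y h).filter (fun e => e.2.1 = u)) :
    (resultMessages ρ x h).filter (fun e => e.1 = u) ⊆
      (resultMessages ρ y h).filter (fun e => e.1 = u) := by
  intro e he
  simp only [resultMessages, Finset.mem_filter, Finset.mem_image, Prod.exists] at he ⊢
  obtain ⟨⟨i, v, k, hp, rfl⟩, rfl⟩ := he
  have h1 : (i, server x h (i, v, k),
      pairCode k.bits (pairCode (v : ℕ).bits (contentOf x i k))) ∈
        (queryMessages x h).filter (fun e => e.2.1 = server x h (i, v, k)) :=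
    Finset.mem_filter.2 ⟨Finset.mem_image_of_mem _ hp, rfl⟩
  simp only at hq
  rw [hq, Finset.mem_filter, queryMessages, Finset.mem_image] at h1
  obtain ⟨⟨⟨i', v', k'⟩, hp', h2⟩, -⟩ := h1
  simp only [Prod.mk.injEq] at h2
  obtain ⟨rfl, h3, h4⟩ := h2
  obtain ⟨hk, h5⟩ := pairCode_inj h4
  obtain ⟨hv, h6⟩ := pairCode_inj h5
  obtain rfl := bits_injective hk
  obtain rfl := Fin.ext (bits_injective hv)
  have hmem : (x v').memory = (y v').memory := by
    rcases mem_servers.1 (server_mem x h (i', v', k')) with h7 | h7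
    · rw [← h7] at hu; exact hu
    · simp only at ha; rw [← h7] at ha; exact ha
  exact ⟨⟨i', v', k', hp', by rw [h3, h6, hmem]⟩, rfl⟩

/-- A result travels with the index of its query, and the index identifies the query in the list of
`i`. -/
theorem result_eq {ρ : Resolution n} {x y : Fin n → NodeInput n} {h : Fin n → ℕ} {i : Fin n}
    (hi : x i = y i) (hr : (resultMessages ρ x h).filter (fun e => e.2.1 = i) =
      (resultMessages ρ y h).filter (fun e => e.2.1 = i)) :
    (x i).queries.map (fun q => ρ.result x q) = (y i).queries.map (fun q => ρ.result y q) := by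
  rw [← hi]
  refine List.map_congr_left fun q hq => ?_
  obtain ⟨k, hk⟩ := List.mem_iff_getElem?.1 hq
  have hk' : contentOf x i k = q.content := by simp [contentOf, hk]
  have h1 : (server x h (i, q.resolver, k), i, pairCode k.bits (ρ.result x q)) ∈
      (resultMessages ρ x h).filter (fun e => e.2.1 = i) := by
    refine Finset.mem_filter.2 ⟨Finset.mem_image.2 ⟨(i, q.resolver, k), ?_, ?_⟩, rfl⟩
    · exact mem_allQueries.2 (mem_queriesTo.2 ⟨q, hk, rfl, hk'⟩)
    · simp only [hk', Resolution.result]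
  rw [hr, Finset.mem_filter, resultMessages, Finset.mem_image] at h1
  obtain ⟨⟨⟨i', v, k'⟩, hp, h2⟩, -⟩ := h1
  simp only [Prod.mk.injEq] at h2
  obtain ⟨-, rfl, h3⟩ := h2
  obtain ⟨h3, h4⟩ := pairCode_inj h3
  obtain rfl := bits_injective h3
  obtain ⟨q', hq', rfl, hc⟩ := mem_queriesTo.1 (mem_allQueries.1 hp)
  rw [← hi, hk, Option.some_inj] at hq'
  subst hq'
  rw [← h4, hc]
  rfl

end Queries


/-! ### Assembling the query algorithm -/

section Main

variable {n : ℕ}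

theorem SizeBounds.mono {c c' : ℕ} {ρ : Resolution n} {x : Fin n → NodeInput n}
    (h : SizeBounds c ρ x) (hc : c ≤ c') : SizeBounds c' ρ x where
  memory i := (h.memory i).trans (Nat.mul_le_mul_right _ hc)
  word i w hw := (h.word i w hw).trans (Nat.mul_le_mul_right _ hc)
  queries i := (h.queries i).trans (Nat.mul_le_mul_right _ hc)
  content i q hq := (h.content i q hq).trans (Nat.mul_le_mul_right _ hc)
  result i q hq := (h.result i q hq).trans (Nat.mul_le_mul_right _ hc)

/-- How many assistants `v` needs, if a node can resolve `N` queries. -/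
def assistants (N : ℕ) (x : Fin n → NodeInput n) (v : Fin n) : ℕ := demand x v / N

variable {c B R : ℕ} {ρ : Resolution n} {Ω : Type} {inp : Ω → Fin n → NodeInput n}

/-- All nodes learn how many assistants every node needs. -/
theorem learnable_assistants (hB : wordLength n ≤ B)
    (hx : ∀ ω, SizeBounds c ρ (inp ω)) :
    Learnable B inp (0 + (c + 1) + 2) (fun i ω ω' => inp ω i = inp ω' i ∧
      assistants (c * n) (inp ω) = assistants (c * n) (inp ω')) := by
  have hcard : ∀ ω i v, (queriesTo (inp ω) i v).card ≤ c * n := fun ω i v =>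
    (Finset.single_le_sum (f := fun v => (queriesTo (inp ω) i v).card)
      (fun _ _ => Nat.zero_le _) (Finset.mem_univ v)).trans
      ((sum_card_queriesTo_le _ i).trans ((hx ω).queries i))
  have h1 := (learnable_input B inp).rounds (c + 1)
    (fun ω i v => (queriesTo (inp ω) i v).card.bits)
    (fun ω i v => (length_bits_le (hcard ω i v)).trans (Nat.mul_le_mul_left _ hB))
    (fun i ω ω' h v => by rw [queriesTo_congr h])
  -- Each `v` now knows its demand. The quotient is at most `n`, so two rounds suffice to broadcast
  -- it.
  have h2 := h1.rounds 2 (fun ω v _ => (assistants (c * n) (inp ω) v).bits)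
    (fun ω v _ => by
      refine (length_bits_le (C := 1) ?_).trans (Nat.mul_le_mul_left _ hB)
      refine Nat.div_le_of_le_mul ?_
      calc demand (inp ω) v ≤ ∑ _i : Fin n, c * n := Finset.sum_le_sum fun i _ => hcard ω i v
        _ = c * n * (1 * n) := by simp; ring)
    (fun v ω ω' h _ => by
      have h3 : demand (inp ω) v = demand (inp ω') v :=
        Finset.sum_congr rfl fun i _ => bits_injective (h.2 i)
      simp only [assistants, h3])
  exact h2.mono fun i ω ω' h => ⟨h.1.1, funext fun v => bits_injective (h.2 v)⟩

/-- Every node learns the memory of the node that it assists. -/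
theorem Learnable.memory (hn : 0 < n) (hB : wordLength n ≤ B)
    (hx : ∀ ω, SizeBounds c ρ (inp ω)) {h : Ω → Fin n → ℕ}
    (hL : Learnable B inp R (fun i ω ω' => inp ω i = inp ω' i ∧ h ω = h ω')) :
    Learnable B inp (R + c * (c + 1) + c * (c + 1)) (fun i ω ω' => inp ω i = inp ω' i ∧
      h ω = h ω' ∧
      (inp ω (assisted (h ω) i)).memory = (inp ω' (assisted (h ω) i)).memory) := by
  let word : Ω → Fin n → ℕ → List Bool := fun ω v m => optionCode ((inp ω v).memory[m]?)
  have hword : ∀ ω v m, (word ω v m).length ≤ (c + 1) * B := by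
    intro ω v m
    simp only [word]
    have h1 := (one_le_wordLength n).trans hB
    rcases h2 : (inp ω v).memory[m]? with _ | w
    · simp [optionCode]
    · have h3 := (hx ω).word v w (List.mem_of_getElem? h2)
      simp only [optionCode, List.length_cons]
      nlinarith
  -- Node `j` stores word `j + n * t` of every memory, `t < c`. In the second hop it forwards to `u`
  -- only words of the node that `u` assists.
  have h1 := hL.family c (c + 1) (fun ω v j t => word ω v (j + n * t))
    (fun ω v j t _ => hword _ _ _) (fun v ω ω' h j t _ => by simp only [word, h.1])
  have h2 := h1.family c (c + 1) (fun ω j u t => word ω (assisted (h ω) u) (j + n * t))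
    (fun ω j u t _ => hword _ _ _)
    (fun j ω ω' h u t ht => by rw [← h.1.2, h.2 _ t ht])
  refine h2.mono fun u ω ω' hr => ⟨hr.1.1.1, hr.1.1.2, List.ext_getElem? fun m => ?_⟩
  by_cases hm : m < c * n
  · have h3 := hr.2 ⟨m % n, Nat.mod_lt _ hn⟩ (m / n)
      (Nat.div_lt_of_lt_mul (by rwa [mul_comm]))
    simp only [Nat.mod_add_div, word, ← hr.1.1.2] at h3
    exact optionCode_injective h3
  · have h4 : ∀ ω v, (inp ω v).memory[m]? = none := fun ω v =>
      List.getElem?_eq_none (((hx ω).memory v).trans (not_lt.1 hm))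
    rw [h4, h4]

theorem card_filter_image_le {α β γ : Type*} [DecidableEq β] [DecidableEq γ] (S : Finset α)
    (f : α → β) (g : β → γ) (b : γ) :
    ((S.image f).filter (fun e => g e = b)).card ≤
      (S.filter (fun p => g (f p) = b)).card := by
  rw [Finset.filter_image]
  exact Finset.card_image_le

/-- All queries are answered in a constant number of rounds. -/
theorem exists_algorithm_queries (b c : ℕ) (hb : 1 ≤ b) (hc : 1 ≤ c) :
    ∃ R : ℕ, ∀ (n : ℕ) (ρ : Resolution n),
      ∃ A : Algorithm n (b * wordLength n) (NodeInput n) (List (List Bool)),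
        ∀ x : Fin n → NodeInput n, SizeBounds c ρ x →
          ∀ i : Fin n, A.outputAfter x R i = (x i).queries.map (fun q => ρ.result x q) := by
  -- `C * n` is the server load `2 * (2 * N + n)` for `N = c * n`. `D` is the sum of `8 * C + 7`,
  -- for counts up to `(8 * C + 6) * n`, and `3 * c + 18`, for message codes.
  let C := 4 * c + 2
  let D := 8 * C + 3 * c + 25
  refine ⟨0 + (c + 1) + 2 + c * (c + 1) + c * (c + 1) + routeRounds C D + routeRounds C D,
    fun n ρ => ?_⟩
  rcases Nat.eq_zero_or_pos n with rfl | hn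
  · obtain ⟨A, -⟩ := (learnable_input (b * wordLength 0)
      (fun x : Fin 0 → NodeInput 0 => x)).exists_algorithm
        (fun _ _ => ([] : List (List Bool))) (fun _ _ _ _ => rfl)
    exact ⟨A, fun _ _ i => i.elim0⟩
  set L := wordLength n with hL
  have hL1 : 1 ≤ L := one_le_wordLength n
  set B := b * L with hBdef
  have hB : L ≤ B := Nat.le_mul_of_pos_left _ hb
  have hB1 : 1 ≤ B := hL1.trans hB
  have hN : 0 < c * n := Nat.mul_pos hc hn
  -- Only inputs that obey the size bounds are possible worlds, so all length and load estimates
  -- hold in every world.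
  let Ω := {x : Fin n → NodeInput n // SizeBounds c ρ x}
  let inp : Ω → Fin n → NodeInput n := Subtype.val
  have hx : ∀ ω, SizeBounds c ρ (inp ω) := Subtype.prop
  let h : Ω → Fin n → ℕ := fun ω => assistants (c * n) (inp ω)
  have hbits : ∀ a ≤ (8 * C + 6) * n, a.bits.length ≤ D * B := fun a ha =>
    (length_bits_le ha).trans (Nat.mul_le_mul (by omega) hB)
  have hcode : ∀ e : Message n, e.2.2.length ≤ (3 * c + 8) * L → e.code.length ≤ D * B :=
    fun e he => (e.length_code_le he).trans (Nat.mul_le_mul (by omega) hB)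
  have hsource : ∀ ω i, ((allQueries (inp ω)).filter (fun p => p.1 = i)).card ≤ C * n := by
    intro ω i
    refine (card_queries_of_source_le _ i).trans (((hx ω).queries i).trans ?_)
    exact Nat.mul_le_mul_right _ (by omega)
  have hserver : ∀ ω u,
      ((allQueries (inp ω)).filter (fun p => server (inp ω) (h ω) p = u)).card ≤ C * n := by
    intro ω u
    refine (card_queries_of_server_le hN (hx ω).queries u).trans (le_of_eq ?_)
    simp only [C]
    ring
  have hquery : ∀ ω i v k, k ∈ queriesTo (inp ω) i v → k.bits.length ≤ (c + 1) * L ∧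
      (contentOf (inp ω) i k).length ≤ c * L ∧
      (ρ v (inp ω v).memory (contentOf (inp ω) i k)).length ≤ c * L := by
    intro ω i v k hk
    obtain ⟨q, hq, rfl, hcont⟩ := mem_queriesTo.1 hk
    have hmem := List.mem_of_getElem? hq
    have hlt := (List.getElem?_eq_some_iff.1 hq).1
    rw [hcont]
    exact ⟨length_bits_le (hlt.le.trans ((hx ω).queries i)), (hx ω).content i q hmem,
      (hx ω).result i q hmem⟩
  have h0 := (learnable_assistants hB hx).memory hn hB hx
  -- the queries are sent to the servers
  obtain ⟨r₁, hL₁, hr₁, hS₁⟩ := h0.route (C := C) (D := D) hn hB1 hbits Message.code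
    Message.code_injective (S := fun ω => queryMessages (inp ω) (h ω))
    (fun ω e he => by
      obtain ⟨⟨i, v, k⟩, hp, rfl⟩ := Finset.mem_image.1 he
      obtain ⟨h2, h3, -⟩ := hquery ω i v k (mem_allQueries.1 hp)
      have h4 := length_bits_le (C := 1) (n := n) (a := v) (by have := v.2; omega)
      refine hcode _ ?_
      simp only [length_pairCode]
      rw [← hL] at h4
      nlinarith)
    (fun e => e.1) (fun e => e.2.1)
    (fun i ω ω' hr => by
      have h1 : h ω' = h ω := hr.2.1.symm
      simp only [h1]
      exact (queryMessages_subset hr.1).antisymm (queryMessages_subset hr.1.symm))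
    (fun ω i => (card_filter_image_le _ _ _ i).trans (hsource ω i))
    (fun ω i => (card_filter_image_le _ _ _ i).trans (hserver ω i))
  -- the results are sent back
  obtain ⟨r₂, hL₂, hr₂, hS₂⟩ := hL₁.route (C := C) (D := D) hn hB1 hbits Message.code
    Message.code_injective (S := fun ω => resultMessages ρ (inp ω) (h ω))
    (fun ω e he => by
      obtain ⟨⟨i, v, k⟩, hp, rfl⟩ := Finset.mem_image.1 he
      obtain ⟨h2, -, h3⟩ := hquery ω i v k (mem_allQueries.1 hp)
      refine hcode _ ?_
      simp only [length_pairCode]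
      nlinarith)
    (fun e => e.1) (fun e => e.2.1)
    (fun u ω ω' hr => by
      obtain ⟨h1, h2, h3⟩ := hr₁ _ _ _ hr
      have h4 := hS₁ _ _ _ hr
      have h5 : h ω' = h ω := h2.symm
      simp only [h5] at h4 ⊢
      have h6 : (inp ω u).memory = (inp ω' u).memory := by rw [h1]
      exact (resultMessages_subset h6 h3 h4).antisymm
        (resultMessages_subset h6.symm h3.symm h4.symm))
    (fun ω i => (card_filter_image_le _ _ _ i).trans (hserver ω i))
    (fun ω i => (card_filter_image_le _ _ _ i).trans (hsource ω i))
  obtain ⟨A, hA⟩ := hL₂.exists_algorithm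
    (fun ω i => (inp ω i).queries.map (fun q => ρ.result (inp ω) q))
    (fun i ω ω' hr => by
      obtain ⟨h1, h2, -⟩ := hr₁ _ _ _ (hr₂ _ _ _ hr)
      have h4 := hS₂ _ _ _ hr
      have h5 : h ω' = h ω := h2.symm
      simp only [h5] at h4
      exact result_eq h1 h4)
  exact ⟨A, fun x hx i => hA ⟨x, hx⟩ i⟩

end Main

end CongestedClique

theorem mainTheorem7 (b c : ℕ) (hb : 1 ≤ b) :
    ∃ R : ℕ, ∀ (n : ℕ) (ρ : CongestedClique.Resolution n),
      ∃ A : CongestedClique.Algorithm n (b * CongestedClique.wordLength n)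
          (CongestedClique.NodeInput n) (List (List Bool)),
        ∀ x : Fin n → CongestedClique.NodeInput n, CongestedClique.SizeBounds c ρ x →
          ∀ i : Fin n, A.outputAfter x R i = (x i).queries.map (fun q => ρ.result x q) := by
  -- Passing to `c + 1` covers `c = 0`, where the divisor `c * n` would vanish.
  obtain ⟨R, hR⟩ := CongestedClique.exists_algorithm_queries b (c + 1) hb (Nat.le_add_left 1 c)
  refine ⟨R, fun n ρ => ?_⟩
  obtain ⟨A, hA⟩ := hR n ρ
  exact ⟨A, fun x hx i => hA x (hx.mono (Nat.le_succ c)) i⟩
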